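/- Setting. There are $n$ agents and $m$ items. Each agent $i$ has an XOS valuation $v_i(S)=\max_{\ell}\sum_{j\in S} v^{\ell}_{i,j}$, given by finitely many (at least one) additive clauses with values $v^\ell_{i,j}\ge 0$. Agents place bids $b_{i,j}\ge 0$. Each item is assigned to an agent with the highest bid on it, ties being broken by an arbitrary but fixed rule, at the price $\max_{i'\ne i} b_{i',j}$ for the winner $i$. If $S_1,\dots,S_n$ are the sets of items won at $b$, then $u_i(b)=v_i(S_i)-\sum_{j\in S_i}\max_{i'\neq i}b_{i',j}$ is the utility of agent $i$ and $SW(b)=\sum_i v_i(S_i)$ is the social welfare; $OPT$ is the maximum of $\sum_i v_i(S_i)$ over all partitions $S_1,\dots,S_n$ of the items. When agent $i$ is activated in the Potential Procedure, its bid stays unchanged if it already is a best response (maximizes $u_i$ against the current bids of the others). Otherwise the agent picks an arbitrary demand set $D$, that is, a maximizer of $v_i(S)-\sum_{j\in S}\max_{i'\neq i}b_{i',j}$, and an arbitrary clause $\ell$ with $\sum_{j\in D}v^\ell_{i,j}=v_i(D)$, and changes its bids to $v^\ell_{i,j}$ for $j\in D$ and $0$ for $j\notin D$. Theorem 5.3.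 There is a function $f:\mathbb N\to\mathbb N$ with $f(k)=\Omega(2^k)$ such that for every $\varepsilon>0$, every $n\ge 2$, every $k\ge 0$ and every tie-breaking rule there are an instance with $n$ agents with XOS valuations and $(n-1)(k+1)$ items, an initial bid vector $b^0$ satisfying strong no-overbidding ($\sum_{j\in S}b^0_{i,j}\le v_i(S)$ for all agents $i$ and all sets $S$ of items), a sequence of activations, and a number $T$ of steps, such that every agent is activated at least $f(k)$ times during the first $T$ steps, and every sequence $b^0,b^1,b^2,\dots$ that arises from these activations through updates of the Potential Procedure (for every choice of demand sets and supporting clauses) satisfies $$SW(b^t)\le\frac{1+\varepsilon}{n-1}\,OPT\qquad\text{for all } 0\le t\le T,$$ and in each of the first $T$ steps the activated agent is not yet playing a best response, so that each of these activations is a strictly improving update. -/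

import Mathlib

open scoped NNReal

/-- A bid profile of `n` agents on `m` items: `b i j` is the bid of agent `i` on item `j`. -/
abbrev Bids (n m : ℕ) : Type := Fin n → Fin m → ℝ≥0

/-- An instance with `n` agents and `m` items in which every agent has an XOS (fractionally
subadditive) valuation, given by a finite nonempty list of additive clauses:
`weight i ℓ j` is the value that the `ℓ`-th clause of agent `i` gives to item `j`. -/
structure XOSInstance (n m : ℕ) where
  clauses : Fin n → ℕ
  weight : (i : Fin n) → Fin (clauses i + 1) → Fin m → ℝ≥0

/-- The XOS valuation of agent `i`: the maximum of the additive clauses. -/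
noncomputable def XOSInstance.value {n m : ℕ} (I : XOSInstance n m) (i : Fin n)
    (S : Finset (Fin m)) : ℝ≥0 :=
  Finset.univ.sup fun ℓ => ∑ j ∈ S, I.weight i ℓ j

/-- The maximum of social welfare over all allocations `o` of the items to the agents. -/
noncomputable def XOSInstance.opt {n m : ℕ} (I : XOSInstance n m) : ℝ≥0 :=
  Finset.univ.sup fun o : Fin m → Fin n =>
    ∑ i, I.value i (Finset.univ.filter fun j => o j = i)

/-- The allocation rule of simultaneous item auctions with a fixed, otherwise arbitrary
tie-breaking: each item goes to an agent with the highest bid on it. -/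
structure AllocationRule (n m : ℕ) where
  winner : Bids n m → Fin m → Fin n
  highest : ∀ (b : Bids n m) (j : Fin m) (i : Fin n), b i j ≤ b (winner b j) j

/-- The set of items won by agent `i`. -/
def AllocationRule.won {n m : ℕ} (R : AllocationRule n m) (b : Bids n m) (i : Fin n) :
    Finset (Fin m) :=
  Finset.univ.filter fun j => R.winner b j = i

/-- The second price that agent `i` faces on item `j`: the highest bid of the other agents. -/
noncomputable def price {n m : ℕ} (b : Bids n m) (i : Fin n) (j : Fin m) : ℝ≥0 :=
  (Finset.univ.erase i).sup fun i' => b i' j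

/-- Social welfare of the allocation at the bid profile `b`. -/
noncomputable def socialWelfare {n m : ℕ} (R : AllocationRule n m) (I : XOSInstance n m)
    (b : Bids n m) : ℝ≥0 :=
  ∑ i, I.value i (R.won b i)

/-- The utility that agent `i` would have from buying the set `S` at the current prices. -/
noncomputable def surplus {n m : ℕ} (I : XOSInstance n m) (b : Bids n m) (i : Fin n)
    (S : Finset (Fin m)) : ℝ :=
  (I.value i S : ℝ) - ∑ j ∈ S, (price b i j : ℝ)

/-- Quasi-linear utility of agent `i` at the bid profile `b`. -/
noncomputable def utility {n m : ℕ} (R : AllocationRule n m) (I : XOSInstance n m)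
    (b : Bids n m) (i : Fin n) : ℝ :=
  surplus I b i (R.won b i)

/-- In the profile `b`, the bid of agent `i` is a best response to the other bids. -/
def IsBestResponse {n m : ℕ} (R : AllocationRule n m) (I : XOSInstance n m)
    (b : Bids n m) (i : Fin n) : Prop :=
  ∀ c : Fin m → ℝ≥0, utility R I (Function.update b i c) i ≤ utility R I b i

/-- `D` is a demand set of agent `i` at the prices given by the other agents' bids. -/
def IsDemandSet {n m : ℕ} (I : XOSInstance n m) (b : Bids n m) (i : Fin n)
    (D : Finset (Fin m)) : Prop :=
  ∀ S : Finset (Fin m), surplus I b i S ≤ surplus I b i D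

/-- One step of the Potential Procedure, in which agent `i` is activated at the profile `b` and
`b'` is the next profile. If the agent already plays a best response, nothing changes. Otherwise
the agent picks some demand set `D` and some clause supporting the valuation on `D`, and bids
this clause on `D` and zero on all other items. -/
def PotentialStep {n m : ℕ} (R : AllocationRule n m) (I : XOSInstance n m)
    (i : Fin n) (b b' : Bids n m) : Prop :=
  (IsBestResponse R I b i ∧ b' = b) ∨
  (¬ IsBestResponse R I b i ∧
    ∃ (D : Finset (Fin m)) (ℓ : Fin (I.clauses i + 1)),
      IsDemandSet I b i D ∧ ∑ j ∈ D, I.weight i ℓ j = I.value i D ∧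
      b' = Function.update b i fun j => if j ∈ D then I.weight i ℓ j else 0)

/-- `b 0, b 1, b 2, …` is a run of the Potential Procedure from `b₀`, where agent `act t` is
activated in the step from `b t` to `b (t + 1)`. -/
def IsPotentialRun {n m : ℕ} (R : AllocationRule n m) (I : XOSInstance n m)
    (b₀ : Bids n m) (act : ℕ → Fin n) (b : ℕ → Bids n m) : Prop :=
  b 0 = b₀ ∧ ∀ t, PotentialStep R I (act t) (b t) (b (t + 1))

/-- Strong no-overbidding: no agent bids more on a set of items in total than its value. -/
def StrongNoOverbidding {n m : ℕ} (I : XOSInstance n m) (b : Bids n m) : Prop :=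
  ∀ (i : Fin n) (S : Finset (Fin m)), ∑ j ∈ S, b i j ≤ I.value i S

/-- How often agent `i` is activated in the first `T` steps. -/
def activations {n : ℕ} (act : ℕ → Fin n) (T : ℕ) (i : Fin n) : ℕ :=
  ((Finset.range T).filter fun t => act t = i).card

/-!
Call one agent the *last* agent, give each other agent a group of `k + 1` items, and call it the
owner of the group. One item of each group is big: the owners value it at `B`, and the last agent
gains `B` on only one big item at a time. The last agent bids on all big items throughout and the
owners never do, so the last agent wins all of them; for large `B` the welfare is then about `B`,
while the optimum is at least `(n - 1) * B`.

Meanwhile the last agent and an owner fight a duel for the contested items of the group, in which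
every vector of bids has exactly one best answer. The bids on a contested item have levels `0`, `1`
and `2`, where `1` overbids `0`, `2` overbids both, and `2` is answered by `0`. The next vector is
the unique best answer if vectors far apart in time *clash* on some item. A sequence of levels may
be continued by its mirror image, with the order of times and of levels reversed; a single new item
supplies the clashes between the two halves, so that the length of the duel is exponential in the
number of items. Finally, lures that decrease from group to group make the last agent take part in
the duels one after the other.
-/

section LevelSequence

/-- The admissible changes of the bid on an item between consecutive times. Bids have levels `0`
(no bid), `1` (a low bid) and `2` (a high bid); the two duelists bid at alternating times, so a bid
is outbid by the opponent, except that a high bid is answered by no bid. -/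
def Overbids (a b : ℕ) : Prop := a < b ∨ a = 2 ∧ b = 0

/-- The levels on an item at which the later bid wastes value against the earlier one. -/
def Clash (a c : ℕ) : Prop := a = c ∧ a ≠ 1

/-- The levels at the times `0, …, 2 * l + 1` of the bids in an alternating duel for the items `ι`,
such that any two times of different parity at distance at least `3` clash on some item. -/
structure LevelSequence (ι : Type) (l : ℕ) where
  level : ℕ → ι → ℕ
  le_two : ∀ t e, level t e ≤ 2
  overbids : ∀ t e, t < 2 * l + 1 → Overbids (level t e) (level (t + 1) e)
  clash : ∀ i j, i + 3 ≤ j → j ≤ 2 * l + 1 → Odd (i + j) → ∃ e, Clash (level i e) (level j e)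

/-- A level sequence that can be continued by its own mirror image: complementing all levels and
running backwards from the last time creates no missing clash at either end. -/
structure ReflectableSequence (ι : Type) (l : ℕ) extends LevelSequence ι l where
  first_ne_one : ∀ e, level 0 e ≠ 1
  last_ne_one : ∀ e, level (2 * l + 1) e ≠ 1
  first_clash : ∀ t, t ≠ 0 → t ≤ 2 * l + 1 → Even t → ∃ e, Clash (level 0 e) (2 - level t e)
  last_clash : ∀ t < 2 * l + 1, Odd t → ∃ e, Clash (level (2 * l + 1) e) (2 - level t e)

theorem Overbids.mirror {a b : ℕ} (h : Overbids a b) (hb : b ≤ 2) :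
    Overbids (2 - b) (2 - a) := by
  unfold Overbids at *
  omega

theorem Clash.mirror {a c : ℕ} (h : Clash a c) (hc : c ≤ 2) : Clash (2 - c) (2 - a) := by
  unfold Clash at *
  omega

theorem overbids_mod_three (t : ℕ) : Overbids (t % 3) ((t + 1) % 3) := by
  unfold Overbids
  omega

/-- Two items whose levels run through `0, 1, 2` cyclically. -/
def baseSequence : ReflectableSequence (Fin 2) 1 where
  level t e := (t + e + 2) % 3
  le_two t e := by omega
  overbids t e _ := by
    have h := overbids_mod_three (t + e + 2)
    rwa [show t + e + 2 + 1 = t + 1 + e + 2 by omega] at h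
  clash i j hij hj _ := ⟨0, by
    obtain ⟨rfl, rfl⟩ : i = 0 ∧ j = 3 := by omega
    simp [Clash]⟩
  first_ne_one := by decide
  last_ne_one := by decide
  first_clash t h0 ht heven := ⟨1, by
    obtain rfl : t = 2 := by
      obtain ⟨r, hr⟩ := heven
      omega
    simp [Clash]⟩
  last_clash t ht hodd := ⟨0, by
    obtain rfl : t = 1 := by
      obtain ⟨r, hr⟩ := hodd
      omega
    simp [Clash]⟩

namespace ReflectableSequence

variable {ι : Type} {l : ℕ} (L : ReflectableSequence ι l)

/-- The levels of a sequence followed by its mirror image. On the additional item `none` every two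
times of different parity on different sides of the middle time `2 * l + 1` clash. -/
def mirroredLevel (t : ℕ) : Option ι → ℕ
  | some e => if t ≤ 2 * l + 1 then L.level t e else 2 - L.level (4 * l + 3 - t) e
  | none =>
    if t < 2 * l + 1 then 2 * (t % 2) else if t = 2 * l + 1 then 1 else 2 * ((t + 1) % 2)

theorem mirroredLevel_some_of_le {t : ℕ} (ht : t ≤ 2 * l + 1) (e : ι) :
    L.mirroredLevel t (some e) = L.level t e := if_pos ht

theorem mirroredLevel_some_of_lt {t : ℕ} (ht : 2 * l + 1 < t) (e : ι) :
    L.mirroredLevel t (some e) = 2 - L.level (4 * l + 3 - t) e := if_neg ht.not_ge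

theorem mirroredLevel_le_two (t : ℕ) (e : Option ι) : L.mirroredLevel t e ≤ 2 := by
  cases e with
  | none => simp only [mirroredLevel]; split_ifs <;> omega
  | some e =>
    simp only [mirroredLevel]
    split_ifs
    exacts [L.le_two t e, Nat.sub_le _ _]

theorem mirroredLevel_overbids {t : ℕ} (e : Option ι) (ht : t < 4 * l + 3) :
    Overbids (L.mirroredLevel t e) (L.mirroredLevel (t + 1) e) := by
  cases e with
  | none => simp only [mirroredLevel, Overbids]; split_ifs <;> omega
  | some e =>
    rcases lt_trichotomy t (2 * l + 1) with h | rfl | h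
    · rw [L.mirroredLevel_some_of_le h.le, L.mirroredLevel_some_of_le h]
      exact L.overbids t e h
    · rw [L.mirroredLevel_some_of_le le_rfl, L.mirroredLevel_some_of_lt (Nat.lt_succ_self _),
        show 4 * l + 3 - (2 * l + 1 + 1) = 2 * l + 1 by omega]
      have hne := L.last_ne_one e
      have hle := L.le_two (2 * l + 1) e
      unfold Overbids
      omega
    · rw [L.mirroredLevel_some_of_lt h, L.mirroredLevel_some_of_lt (by omega),
        show 4 * l + 3 - t = 4 * l + 3 - (t + 1) + 1 by omega]
      exact (L.overbids _ e (by omega)).mirror (L.le_two _ e)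

theorem mirroredLevel_clash_none {i j : ℕ} (hi : i < 2 * l + 1) (hj : 2 * l + 1 < j)
    (hodd : Odd (i + j)) :
    Clash (L.mirroredLevel i none) (L.mirroredLevel j none) := by
  obtain ⟨r, hr⟩ := hodd
  simp only [mirroredLevel, Clash]
  split_ifs <;> omega

theorem mirroredLevel_clash {i j : ℕ} (hij : i + 3 ≤ j) (hj : j ≤ 4 * l + 3) (hodd : Odd (i + j)) :
    ∃ e, Clash (L.mirroredLevel i e) (L.mirroredLevel j e) := by
  by_cases hjl : j ≤ 2 * l + 1
  · obtain ⟨e, he⟩ := L.clash i j hij hjl hodd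
    refine ⟨some e, ?_⟩
    rwa [L.mirroredLevel_some_of_le (by omega), L.mirroredLevel_some_of_le hjl]
  push Not at hjl
  rcases lt_trichotomy i (2 * l + 1) with hi | rfl | hi
  · exact ⟨none, L.mirroredLevel_clash_none hi hjl hodd⟩
  · obtain ⟨e, he⟩ := L.last_clash (4 * l + 3 - j) (by omega) (by
      obtain ⟨r, hr⟩ := hodd
      exact ⟨3 * l + 1 - r, by omega⟩)
    refine ⟨some e, ?_⟩
    rwa [L.mirroredLevel_some_of_le le_rfl, L.mirroredLevel_some_of_lt hjl]
  · obtain ⟨e, he⟩ := L.clash (4 * l + 3 - j) (4 * l + 3 - i) (by omega) (by omega) (by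
      obtain ⟨r, hr⟩ := hodd
      exact ⟨4 * l + 2 - r, by omega⟩)
    refine ⟨some e, ?_⟩
    rw [L.mirroredLevel_some_of_lt hi, L.mirroredLevel_some_of_lt hjl]
    exact he.mirror (L.le_two _ e)

theorem mirroredLevel_first_clash {t : ℕ} (h0 : t ≠ 0) (heven : Even t) :
    ∃ e, Clash (L.mirroredLevel 0 e) (2 - L.mirroredLevel t e) := by
  by_cases ht : t ≤ 2 * l + 1
  · obtain ⟨e, he⟩ := L.first_clash t h0 ht heven
    refine ⟨some e, ?_⟩
    rwa [L.mirroredLevel_some_of_le (Nat.zero_le _), L.mirroredLevel_some_of_le ht]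
  · obtain ⟨r, hr⟩ := heven
    refine ⟨none, ?_⟩
    simp only [mirroredLevel, Clash]
    split_ifs <;> omega

theorem mirroredLevel_last_clash (hl : 1 ≤ l) {t : ℕ} (ht : t < 4 * l + 3) (hodd : Odd t) :
    ∃ e, Clash (L.mirroredLevel (4 * l + 3) e) (2 - L.mirroredLevel t e) := by
  rcases lt_trichotomy t (2 * l + 1) with h | rfl | h
  · obtain ⟨r, hr⟩ := hodd
    refine ⟨none, ?_⟩
    simp only [mirroredLevel, Clash]
    split_ifs <;> omega
  · obtain ⟨e, he⟩ := L.clash 0 (2 * l + 1) (by omega) le_rfl (by rwa [zero_add])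
    refine ⟨some e, ?_⟩
    rw [L.mirroredLevel_some_of_lt (by omega), L.mirroredLevel_some_of_le le_rfl, Nat.sub_self,
      ← he.1]
    have h0 := L.first_ne_one e
    have h2 := L.le_two 0 e
    unfold Clash
    omega
  · obtain ⟨e, he⟩ := L.first_clash (4 * l + 3 - t) (by omega) (by omega) (by
      obtain ⟨r, hr⟩ := hodd
      exact ⟨2 * l + 1 - r, by omega⟩)
    refine ⟨some e, ?_⟩
    rw [L.mirroredLevel_some_of_lt (by omega), L.mirroredLevel_some_of_lt h, Nat.sub_self]
    have h2 := L.le_two (4 * l + 3 - t) e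
    unfold Clash at *
    omega

/-- Continuing a level sequence by its mirror image doubles its length at the cost of one item. -/
def double (hl : 1 ≤ l) : ReflectableSequence (Option ι) (2 * l + 1) where
  level := L.mirroredLevel
  le_two := L.mirroredLevel_le_two
  overbids t e ht := L.mirroredLevel_overbids e (by omega)
  clash i j hij hj := L.mirroredLevel_clash hij (by omega)
  first_ne_one
    | none => by simp [mirroredLevel]
    | some e => L.first_ne_one e
  last_ne_one
    | none => by simp only [mirroredLevel]; split_ifs <;> omega
    | some e => by
      rw [L.mirroredLevel_some_of_lt (by omega),
        show 4 * l + 3 - (2 * (2 * l + 1) + 1) = 0 by omega]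
      have := L.first_ne_one e
      omega
  first_clash t h0 _ := L.mirroredLevel_first_clash h0
  last_clash t ht := by
    rw [show 2 * (2 * l + 1) + 1 = 4 * l + 3 by ring] at ht ⊢
    exact L.mirroredLevel_last_clash hl ht

end ReflectableSequence

theorem exists_reflectableSequence (κ : ℕ) :
    ∃ (ι : Type) (_ : Fintype ι), Fintype.card ι = κ + 2 ∧
      Nonempty (ReflectableSequence ι (2 ^ (κ + 1) - 1)) := by
  induction κ with
  | zero => exact ⟨Fin 2, inferInstance, rfl, ⟨baseSequence⟩⟩
  | succ κ ih =>
    obtain ⟨ι, _, hcard, ⟨L⟩⟩ := ih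
    have hpow : 2 ≤ 2 ^ (κ + 1) := Nat.le_self_pow (Nat.succ_ne_zero κ) 2
    refine ⟨Option ι, inferInstance, by rw [Fintype.card_option, hcard], ?_⟩
    rw [show 2 ^ (κ + 1 + 1) - 1 = 2 * (2 ^ (κ + 1) - 1) + 1 by omega]
    exact ⟨L.double (by omega)⟩

namespace LevelSequence

variable {ι : Type} {l : ℕ}

/-- A level sequence together with three items on which the levels run through `0, 1, 2` cyclically,
so that at every time some item has level `1`. -/
def withClock (L : LevelSequence ι l) : LevelSequence (ι ⊕ Fin 3) l where
  level t := Sum.elim (L.level t) fun c => (t + c) % 3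
  le_two t
    | .inl e => L.le_two t e
    | .inr c => Nat.le_of_lt_succ (Nat.mod_lt _ three_pos)
  overbids t
    | .inl e => L.overbids t e
    | .inr c => fun _ => by
      simpa only [Sum.elim_inr, add_right_comm] using overbids_mod_three (t + c)
  clash i j hij hj hodd :=
    let ⟨e, he⟩ := L.clash i j hij hj hodd
    ⟨.inl e, he⟩

theorem exists_withClock_level_eq_one (L : LevelSequence ι l) (t : ℕ) :
    ∃ e, L.withClock.level t e = 1 := by
  refine ⟨.inr (Fin.ofNat 3 (1 + 2 * t)), ?_⟩
  simp only [withClock, Sum.elim_inr, Fin.ofNat]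
  omega

end LevelSequence

end LevelSequence

section Duel

/-- Two duelists bid alternately for the items `ι`: the bids at time `t` are `bid t`, and
`reserve t` is an extra value that the bidder obtains for free with this vector. Against the bids at
time `s` the vector of time `s + 1` is the most profitable one among those of its bidder. -/
structure Duel (ι : Type) [Fintype ι] (l : ℕ) where
  bid : ℕ → ι → ℕ
  reserve : ℕ → ℕ
  best : ∀ s t, s < 2 * l + 1 → t ≤ 2 * l + 1 → Odd (s + t) → t ≠ s + 1 →
    reserve t + ∑ e, (bid t e - bid s e) < reserve (s + 1) + ∑ e, (bid (s + 1) e - bid s e)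
  outbid : ∀ s e, s < 2 * l + 1 → bid (s + 1) e = 0 ∨ bid s e < bid (s + 1) e
  progress : ∀ s < 2 * l + 1, ∃ e, (s ≠ 0 → bid (s - 1) e = 0) ∧
    0 < bid s e ∧ bid s e < bid (s + 1) e

/-- The compensation for not bidding high on an item. -/
def slack (a : ℕ) : ℕ := if a = 2 then 0 else 1

variable {a b c : ℕ}

theorem Overbids.slack_add_le (h : Overbids a b) (hb : b ≤ 2) (hc : c ≤ 2) :
    slack c + (c - a) ≤ slack b + (b - a) := by
  unfold Overbids slack at *
  split_ifs <;> omega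

theorem Overbids.slack_add_lt (h : Overbids a b) (hb : b ≤ 2) (hclash : Clash a c) :
    slack c + (c - a) < slack b + (b - a) := by
  unfold Overbids Clash slack at *
  split_ifs <;> omega

namespace LevelSequence

variable {ι : Type} [Fintype ι] {l : ℕ} (L : LevelSequence ι l)

theorem sum_slack_add_le {s t : ℕ} (hs : s < 2 * l + 1) :
    ∑ e, (slack (L.level t e) + (L.level t e - L.level s e)) ≤
      ∑ e, (slack (L.level (s + 1) e) + (L.level (s + 1) e - L.level s e)) :=
  Finset.sum_le_sum fun e _ => (L.overbids s e hs).slack_add_le (L.le_two _ e) (L.le_two t e)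

theorem sum_slack_add_lt {s t : ℕ} (hs : s < 2 * l + 1)
    (hclash : ∃ e, Clash (L.level s e) (L.level t e)) :
    ∑ e, (slack (L.level t e) + (L.level t e - L.level s e)) <
      ∑ e, (slack (L.level (s + 1) e) + (L.level (s + 1) e - L.level s e)) := by
  obtain ⟨e, he⟩ := hclash
  exact Finset.sum_lt_sum
    (fun e _ => (L.overbids s e hs).slack_add_le (L.le_two _ e) (L.le_two t e))
    ⟨e, Finset.mem_univ e, (L.overbids s e hs).slack_add_lt (L.le_two _ e) he⟩

/-- The value of a duel vector apart from the bids. The summand `t` decides between vectors that are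
equally good item by item, which happens only for the bidder's previous vector. -/
def reserve (t : ℕ) : ℕ := (2 * l + 2) * ∑ e, slack (L.level t e) + t

theorem reserve_add_sum_sub (s t : ℕ) :
    L.reserve t + ∑ e, ((2 * l + 2) * L.level t e - (2 * l + 2) * L.level s e) =
      (2 * l + 2) * ∑ e, (slack (L.level t e) + (L.level t e - L.level s e)) + t := by
  simp only [reserve, ← Nat.mul_sub, ← Finset.mul_sum, Finset.sum_add_distrib]
  ring

theorem reserve_add_sum_sub_lt {s t : ℕ} (hs : s < 2 * l + 1) (ht : t ≤ 2 * l + 1)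
    (hodd : Odd (s + t)) (hne : t ≠ s + 1) :
    L.reserve t + ∑ e, ((2 * l + 2) * L.level t e - (2 * l + 2) * L.level s e) <
      L.reserve (s + 1) +
        ∑ e, ((2 * l + 2) * L.level (s + 1) e - (2 * l + 2) * L.level s e) := by
  rw [reserve_add_sum_sub, reserve_add_sum_sub]
  by_cases hprev : t + 1 = s
  · have := Nat.mul_le_mul_left (2 * l + 2) (L.sum_slack_add_le hs (t := t))
    omega
  have hclash : ∃ e, Clash (L.level s e) (L.level t e) := by
    have hfar : s + 3 ≤ t ∨ t + 3 ≤ s := by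
      obtain ⟨r, hr⟩ := hodd
      omega
    rcases hfar with h | h
    · exact L.clash s t h ht hodd
    · obtain ⟨e, he, hne⟩ := L.clash t s h hs.le (by rwa [add_comm])
      exact ⟨e, he.symm, he ▸ hne⟩
  have := Nat.mul_le_mul_left (2 * l + 2) (L.sum_slack_add_lt hs hclash)
  rw [Nat.mul_succ] at this
  omega

/-- The duel with bids proportional to the levels. -/
def toDuel (hone : ∀ t, ∃ e, L.level t e = 1) : Duel ι l where
  bid t e := (2 * l + 2) * L.level t e
  reserve := L.reserve
  best _ _ := L.reserve_add_sum_sub_lt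
  outbid s e hs := (L.overbids s e hs).symm.imp (fun h => by rw [h.2, mul_zero])
    fun h => Nat.mul_lt_mul_of_pos_left h (Nat.succ_pos _)
  progress s hs := by
    obtain ⟨e, he⟩ := hone s
    refine ⟨e, fun h0 => ?_, by rw [he]; omega, Nat.mul_lt_mul_of_pos_left ?_ (Nat.succ_pos _)⟩
    · have h := L.overbids (s - 1) e (by omega)
      rw [Nat.sub_add_cancel (Nat.pos_of_ne_zero h0), he] at h
      rw [show L.level (s - 1) e = 0 by unfold Overbids at h; omega, mul_zero]
    · have h := L.overbids s e hs
      unfold Overbids at h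
      omega

end LevelSequence

theorem exists_duel (κ : ℕ) :
    ∃ (ι : Type) (_ : Fintype ι), Fintype.card ι = κ + 5 ∧ Nonempty (Duel ι (2 ^ (κ + 1) - 1)) := by
  obtain ⟨ι, _, hcard, ⟨L⟩⟩ := exists_reflectableSequence κ
  refine ⟨ι ⊕ Fin 3, inferInstance, by simp [hcard], ?_⟩
  exact ⟨L.withClock.toDuel L.exists_withClock_level_eq_one⟩

end Duel

section BestReply

variable {n m : ℕ}

namespace XOSInstance

variable (I : XOSInstance n m)

theorem sum_weight_le_value (i : Fin n) (ℓ : Fin (I.clauses i + 1)) (S : Finset (Fin m)) :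
    ∑ j ∈ S, I.weight i ℓ j ≤ I.value i S :=
  Finset.le_sup (f := fun ℓ => ∑ j ∈ S, I.weight i ℓ j) (Finset.mem_univ ℓ)

theorem exists_value_eq (i : Fin n) (S : Finset (Fin m)) :
    ∃ ℓ, I.value i S = ∑ j ∈ S, I.weight i ℓ j := by
  obtain ⟨ℓ, -, h⟩ := Finset.exists_mem_eq_sup Finset.univ Finset.univ_nonempty
    (fun ℓ => ∑ j ∈ S, I.weight i ℓ j)
  exact ⟨ℓ, h⟩

/-- The most that agent `i` can gain with clause `ℓ` at the current prices. -/
noncomputable def gain (b : Bids n m) (i : Fin n) (ℓ : Fin (I.clauses i + 1)) : ℝ :=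
  ∑ j, max ((I.weight i ℓ j : ℝ) - price b i j) 0

variable {I} {b : Bids n m} {i : Fin n} {S : Finset (Fin m)}

theorem sum_sub_le_gain (ℓ : Fin (I.clauses i + 1)) :
    ∑ j ∈ S, ((I.weight i ℓ j : ℝ) - price b i j) ≤ I.gain b i ℓ :=
  (Finset.sum_le_sum fun _ _ => le_max_left _ _).trans
    (Finset.sum_le_sum_of_subset_of_nonneg (Finset.subset_univ S) fun _ _ _ => le_max_right _ _)

theorem sum_sub_lt_gain {ℓ : Fin (I.clauses i + 1)} {j : Fin m} (hj : j ∉ S)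
    (h : price b i j < I.weight i ℓ j) :
    ∑ j ∈ S, ((I.weight i ℓ j : ℝ) - price b i j) < I.gain b i ℓ :=
  (Finset.sum_le_sum fun _ _ => le_max_left _ (0 : ℝ)).trans_lt
    (Finset.sum_lt_sum_of_subset (Finset.subset_univ S) (Finset.mem_univ j) hj
      (lt_max_of_lt_left (sub_pos.2 (NNReal.coe_lt_coe.2 h))) fun _ _ _ => le_max_right _ _)

theorem surplus_eq_of_value_eq {ℓ : Fin (I.clauses i + 1)}
    (h : I.value i S = ∑ j ∈ S, I.weight i ℓ j) :
    surplus I b i S = ∑ j ∈ S, ((I.weight i ℓ j : ℝ) - price b i j) := by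
  rw [surplus, h, Finset.sum_sub_distrib, NNReal.coe_sum]

theorem sum_sub_le_surplus (ℓ : Fin (I.clauses i + 1)) :
    ∑ j ∈ S, ((I.weight i ℓ j : ℝ) - price b i j) ≤ surplus I b i S := by
  rw [surplus, Finset.sum_sub_distrib, ← NNReal.coe_sum]
  gcongr
  exact I.sum_weight_le_value i ℓ S

end XOSInstance

theorem price_update_self (b : Bids n m) (i : Fin n) (c : Fin m → ℝ≥0) (j : Fin m) :
    price (Function.update b i c) i j = price b i j :=
  Finset.sup_congr rfl fun i' hi' => by rw [Function.update_of_ne (Finset.ne_of_mem_erase hi')]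

theorem utility_update (R : AllocationRule n m) (I : XOSInstance n m) (b : Bids n m) (i : Fin n)
    (c : Fin m → ℝ≥0) :
    utility R I (Function.update b i c) i = surplus I b i (R.won (Function.update b i c) i) := by
  simp only [utility, surplus, price_update_self]

theorem le_price (b : Bids n m) {i i' : Fin n} (h : i' ≠ i) (j : Fin m) :
    b i' j ≤ price b i j :=
  Finset.le_sup (f := fun i' => b i' j) (Finset.mem_erase.2 ⟨h, Finset.mem_univ i'⟩)

namespace AllocationRule

variable (R : AllocationRule n m) {b : Bids n m} {i : Fin n} {j : Fin m}

theorem mem_won : j ∈ R.won b i ↔ R.winner b j = i := by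
  simp [won]

theorem mem_won_of_price_lt (h : price b i j < b i j) : j ∈ R.won b i := by
  by_contra hj
  exact h.not_ge ((R.highest b j i).trans (le_price b (mt R.mem_won.2 hj) j))

theorem le_of_mem_won (h : j ∈ R.won b i) (i' : Fin n) : b i' j ≤ b i j :=
  R.mem_won.1 h ▸ R.highest b j i'

theorem price_le_of_mem_won (h : j ∈ R.won b i) : price b i j ≤ b i j :=
  Finset.sup_le fun i' _ => R.le_of_mem_won h i'

end AllocationRule

/-- At the profile `b`, clause `ℓ` is the only reply of agent `i` that the Potential Procedure can
produce: up to equal weights it is the unique best clause, it overbids the price wherever it is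
nonzero, and it strictly gains an item that agent `i` cannot win with its present bid. -/
structure IsDecisive (I : XOSInstance n m) (b : Bids n m) (i : Fin n)
    (ℓ : Fin (I.clauses i + 1)) : Prop where
  best : ∀ ℓ', I.weight i ℓ' = I.weight i ℓ ∨ I.gain b i ℓ' < I.gain b i ℓ
  outbid : ∀ j, I.weight i ℓ j = 0 ∨ price b i j < I.weight i ℓ j
  contested : ∃ j, b i j < price b i j ∧ price b i j < I.weight i ℓ j

namespace IsDecisive

variable {I : XOSInstance n m} {R : AllocationRule n m} {b : Bids n m} {i : Fin n}
  {ℓ : Fin (I.clauses i + 1)}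

theorem surplus_lt_gain (h : IsDecisive I b i ℓ) {S : Finset (Fin m)} {j : Fin m} (hj : j ∉ S)
    (hw : price b i j < I.weight i ℓ j) : surplus I b i S < I.gain b i ℓ := by
  obtain ⟨ℓ', hval⟩ := I.exists_value_eq i S
  rw [XOSInstance.surplus_eq_of_value_eq hval]
  rcases h.best ℓ' with heq | hlt
  · rw [heq]
    exact XOSInstance.sum_sub_lt_gain hj hw
  · exact (XOSInstance.sum_sub_le_gain ℓ').trans_lt hlt

theorem gain_le_surplus_won_update (h : IsDecisive I b i ℓ) :
    I.gain b i ℓ ≤ surplus I b i (R.won (Function.update b i (I.weight i ℓ)) i) := by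
  refine le_trans ?_ (XOSInstance.sum_sub_le_surplus ℓ)
  rw [XOSInstance.gain,
    ← Finset.sum_subset (Finset.subset_univ (R.won (Function.update b i (I.weight i ℓ)) i))]
  · refine Finset.sum_le_sum fun j hj => max_le le_rfl (sub_nonneg.2 ?_)
    have hle := R.price_le_of_mem_won hj
    rw [price_update_self, Function.update_self] at hle
    exact NNReal.coe_le_coe.2 hle
  · intro j _ hj
    rcases h.outbid j with hzero | hlt
    · simp [hzero]
    · refine absurd (R.mem_won_of_price_lt ?_) hj
      rwa [price_update_self, Function.update_self]

theorem not_isBestResponse (h : IsDecisive I b i ℓ) : ¬ IsBestResponse R I b i := by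
  intro hbr
  obtain ⟨j, hlt, hw⟩ := h.contested
  have hnot : j ∉ R.won b i := fun hj => (R.price_le_of_mem_won hj).not_gt hlt
  refine (h.surplus_lt_gain hnot hw).not_ge ((h.gain_le_surplus_won_update (R := R)).trans ?_)
  rw [← utility_update]
  exact hbr (I.weight i ℓ)

theorem eq_update_of_potentialStep (h : IsDecisive I b i ℓ) {b' : Bids n m}
    (hstep : PotentialStep R I i b b') : b' = Function.update b i (I.weight i ℓ) := by
  rcases hstep with ⟨hbr, -⟩ | ⟨-, D, ℓ', hD, hval, rfl⟩
  · exact absurd hbr h.not_isBestResponse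
  have hgain : I.gain b i ℓ ≤ surplus I b i D :=
    (h.gain_le_surplus_won_update (R := R)).trans (hD _)
  have hw : I.weight i ℓ' = I.weight i ℓ := by
    refine (h.best ℓ').resolve_right fun hlt => hgain.not_gt ?_
    rw [XOSInstance.surplus_eq_of_value_eq hval.symm]
    exact (XOSInstance.sum_sub_le_gain ℓ').trans_lt hlt
  congr 1
  funext j
  split_ifs with hj
  · rw [hw]
  · exact ((h.outbid j).resolve_right fun hlt => hgain.not_gt (h.surplus_lt_gain hj hlt)).symm

end IsDecisive

theorem IsPotentialRun.eq_of_isDecisive {R : AllocationRule n m} {I : XOSInstance n m}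
    {b₀ : Bids n m} {act : ℕ → Fin n} {T : ℕ} {a b : ℕ → Bids n m}
    (hb : IsPotentialRun R I b₀ act b) (h0 : a 0 = b₀)
    (hstep : ∀ t < T, ∃ ℓ, IsDecisive I (a t) (act t) ℓ ∧
      a (t + 1) = Function.update (a t) (act t) (I.weight (act t) ℓ)) :
    ∀ t ≤ T, b t = a t
  | 0, _ => hb.1.trans h0.symm
  | t + 1, ht => by
    obtain ⟨ℓ, hdec, hnext⟩ := hstep t ht
    have hb' := hb.2 t
    rw [hb.eq_of_isDecisive h0 hstep t (Nat.le_of_succ_le ht)] at hb'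
    rw [hdec.eq_update_of_potentialStep hb', hnext]

end BestReply

section NatInstance

variable {n m : ℕ} {β γ : Type}

/-- The bid profile with natural bids `a` on items `β` that are numbered by `σ`. -/
def castBids (σ : Fin m ≃ β) (a : Fin n → β → ℕ) : Bids n m := fun i x => a i (σ x)

/-- The counterpart of `price` for natural bids. -/
def natPrice (a : Fin n → β → ℕ) (i : Fin n) (y : β) : ℕ :=
  (Finset.univ.erase i).sup fun i' => a i' y

theorem price_castBids (σ : Fin m ≃ β) (a : Fin n → β → ℕ) (i : Fin n) (x : Fin m) :
    price (castBids σ a) i x = natPrice a i (σ x) :=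
  (Nat.cast_finsetSup _ _).symm

variable [Fintype γ] [Nonempty γ]

/-- The instance in which the clauses of agent `i` are the natural weights `w i c` with `c : γ` on
items `β` that are numbered by `σ`. -/
noncomputable def natInstance (σ : Fin m ≃ β) (w : Fin n → γ → β → ℕ) : XOSInstance n m where
  clauses _ := Fintype.card γ - 1
  weight i ℓ x := w i ((Fintype.equivFin γ).symm
    (ℓ.cast (Nat.sub_add_cancel Fintype.card_pos))) (σ x)

variable {σ : Fin m ≃ β} {w : Fin n → γ → β → ℕ} {i : Fin n}

theorem exists_natInstance_weight_eq (c : γ) :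
    ∃ ℓ, (natInstance σ w).weight i ℓ = fun x => (w i c (σ x) : ℝ≥0) := by
  refine ⟨(Fintype.equivFin γ c).cast (Nat.sub_add_cancel Fintype.card_pos).symm, ?_⟩
  simp [natInstance]

theorem exists_eq_natInstance_weight (ℓ : Fin ((natInstance σ w).clauses i + 1)) :
    ∃ c, (natInstance σ w).weight i ℓ = fun x => (w i c (σ x) : ℝ≥0) :=
  ⟨_, rfl⟩

theorem sum_le_natInstance_value (c : γ) (S : Finset (Fin m)) :
    ((∑ x ∈ S, w i c (σ x) : ℕ) : ℝ≥0) ≤ (natInstance σ w).value i S := by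
  obtain ⟨ℓ, hℓ⟩ := exists_natInstance_weight_eq (σ := σ) (w := w) (i := i) c
  simpa [hℓ] using (natInstance σ w).sum_weight_le_value i ℓ S

theorem natInstance_value_le {S : Finset (Fin m)} {C : ℕ}
    (h : ∀ c, ∑ x ∈ S, w i c (σ x) ≤ C) : (natInstance σ w).value i S ≤ C :=
  Finset.sup_le fun ℓ _ => by
    obtain ⟨c, hc⟩ := exists_eq_natInstance_weight ℓ
    simp only [hc]
    exact_mod_cast h c

variable [Fintype β]

theorem natInstance_gain {a : Fin n → β → ℕ} {ℓ : Fin ((natInstance σ w).clauses i + 1)} {c : γ}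
    (hc : (natInstance σ w).weight i ℓ = fun x => (w i c (σ x) : ℝ≥0)) :
    (natInstance σ w).gain (castBids σ a) i ℓ = (∑ y, (w i c y - natPrice a i y) : ℕ) := by
  have hcast (u v : ℕ) : max ((u : ℝ) - v) 0 = (u - v : ℕ) := by
    rcases le_total u v with h | h <;> simp [h]
  simp only [XOSInstance.gain, hc, price_castBids, NNReal.coe_natCast, hcast]
  rw [Nat.cast_sum, ← Equiv.sum_comp σ]

/-- The counterpart of `IsDecisive` for natural weights and bids. -/
structure IsNatDecisive (w : Fin n → γ → β → ℕ) (a : Fin n → β → ℕ) (i : Fin n) (c : γ) :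
    Prop where
  best : ∀ c', w i c' = w i c ∨
    ∑ y, (w i c' y - natPrice a i y) < ∑ y, (w i c y - natPrice a i y)
  outbid : ∀ y, w i c y = 0 ∨ natPrice a i y < w i c y
  contested : ∃ y, a i y < natPrice a i y ∧ natPrice a i y < w i c y

theorem IsNatDecisive.exists_isDecisive {a : Fin n → β → ℕ} {c : γ} (h : IsNatDecisive w a i c)
    (σ : Fin m ≃ β) :
    ∃ ℓ, IsDecisive (natInstance σ w) (castBids σ a) i ℓ ∧
      castBids σ (Function.update a i (w i c)) =
        Function.update (castBids σ a) i ((natInstance σ w).weight i ℓ) := by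
  obtain ⟨ℓ, hℓ⟩ := exists_natInstance_weight_eq (σ := σ) (w := w) (i := i) c
  refine ⟨ℓ, ⟨fun ℓ' => ?_, fun x => ?_, ?_⟩, ?_⟩
  · obtain ⟨c', hc'⟩ := exists_eq_natInstance_weight ℓ'
    rw [natInstance_gain hℓ, natInstance_gain hc', hc', hℓ]
    exact (h.best c').imp (fun heq => by rw [heq]) Nat.cast_lt.2
  · simp only [hℓ, price_castBids]
    exact_mod_cast h.outbid (σ x)
  · obtain ⟨y, hlt, hw⟩ := h.contested
    refine ⟨σ.symm y, ?_⟩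
    rw [hℓ, price_castBids]
    simpa [castBids] using ⟨hlt, hw⟩
  · rw [hℓ]
    funext i' x
    rcases eq_or_ne i' i with rfl | hne
    · simp [castBids]
    · simp [castBids, Function.update_of_ne hne]

end NatInstance

section Group

variable {N : ℕ} {α : Type}

/-- The weights that are `f` on the items of group `j` and zero on all other groups. -/
def onGroup (j : Fin N) (f : α → ℕ) (y : Fin N × α) : ℕ := if y.1 = j then f y.2 else 0

@[simp]
theorem onGroup_self (j : Fin N) (f : α → ℕ) (z : α) : onGroup j f (j, z) = f z := if_pos rfl

theorem onGroup_of_ne {j : Fin N} {y : Fin N × α} (h : y.1 ≠ j) (f : α → ℕ) : onGroup j f y = 0 :=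
  if_neg h

theorem sum_onGroup_sub [Fintype α] (j : Fin N) (f : α → ℕ) (p : Fin N × α → ℕ) :
    ∑ y, (onGroup j f y - p y) = ∑ z, (f z - p (j, z)) := by
  rw [Fintype.sum_prod_type, Fintype.sum_eq_single j]
  · simp only [onGroup_self]
  · intro g hg
    simp only [onGroup_of_ne (y := (g, _)) hg, Nat.zero_sub, Finset.sum_const_zero]

theorem sum_onGroup [Fintype α] (j : Fin N) (f : α → ℕ) : ∑ y, onGroup j f y = ∑ z, f z :=
  sum_onGroup_sub j f 0

theorem natPrice_last (p : Fin N → α → ℕ) (x : Fin N × α → ℕ) (y : Fin N × α) :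
    natPrice (Fin.snoc (fun j => onGroup j (p j)) x : Fin (N + 1) → Fin N × α → ℕ) (Fin.last N) y =
      p y.1 y.2 := by
  apply le_antisymm
  · refine Finset.sup_le fun i hi => ?_
    obtain ⟨j, rfl⟩ := Fin.exists_castSucc_eq.2 (Finset.ne_of_mem_erase hi)
    rw [Fin.snoc_castSucc]
    unfold onGroup
    split_ifs with h
    exacts [h ▸ le_rfl, Nat.zero_le _]
  · have hmem : y.1.castSucc ∈ Finset.univ.erase (Fin.last N) := by simp
    refine le_trans ?_ (Finset.le_sup hmem)
    rw [Fin.snoc_castSucc, onGroup_self y.1 (p y.1) y.2]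

theorem natPrice_castSucc (p : Fin N → α → ℕ) (x : Fin N × α → ℕ) (j : Fin N) (z : α) :
    natPrice (Fin.snoc (fun j => onGroup j (p j)) x : Fin (N + 1) → Fin N × α → ℕ) j.castSucc
      (j, z) = x (j, z) := by
  apply le_antisymm
  · refine Finset.sup_le fun i hi => ?_
    cases i using Fin.lastCases with
    | last => rw [Fin.snoc_last]
    | cast j' =>
      rw [Fin.snoc_castSucc, onGroup_of_ne]
      · exact Nat.zero_le _
      · rintro rfl
        simp at hi
  · have hmem : Fin.last N ∈ Finset.univ.erase j.castSucc :=
      Finset.mem_erase.2 ⟨j.castSucc_ne_last.symm, Finset.mem_univ _⟩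
    refine le_trans ?_ (Finset.le_sup hmem)
    rw [Fin.snoc_last]

end Group

namespace Duel

variable {ι : Type} [Fintype ι] {l : ℕ} (D : Duel ι l) {N : ℕ}

/-- A strict upper bound on the total value of each vector of the duel. -/
def gap : ℕ := 1 + ∑ t ∈ Finset.range (2 * l + 2), (D.reserve t + ∑ e, D.bid t e)

theorem reserve_add_sum_bid_lt_gap {t : ℕ} (ht : t ≤ 2 * l + 1) :
    D.reserve t + ∑ e, D.bid t e < D.gap := by
  rw [gap, Nat.lt_one_add_iff]
  exact Finset.single_le_sum (f := fun t => D.reserve t + ∑ e, D.bid t e)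
    (fun _ _ => Nat.zero_le _) (Finset.mem_range.2 (Nat.lt_succ_of_le ht))

/-- The value that makes the fight for group `j` attractive for the last agent. It decreases with
`j`, so that the groups are fought for one after the other. -/
def lure (j : Fin N) : ℕ := (N - j) * D.gap

theorem gap_le_lure (j : Fin N) : D.gap ≤ D.lure j :=
  Nat.le_mul_of_pos_left _ (Nat.sub_pos_of_lt j.isLt)

theorem lure_le (j : Fin N) : D.lure j ≤ N * D.gap :=
  Nat.mul_le_mul_right _ (Nat.sub_le _ _)

theorem lure_add_gap_le {j j' : Fin N} (h : j < j') : D.lure j' + D.gap ≤ D.lure j := by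
  rw [lure, lure, ← Nat.succ_mul]
  exact Nat.mul_le_mul_right _ (by omega)

theorem gap_pos : 0 < D.gap := Nat.lt_of_lt_of_le Nat.one_pos (Nat.le_add_right _ _)

/-- The weights on group `j` of the last agent, who plays the odd times `t` of the duel. A group
consists of a big item, a base item, a key item and the contested items `ι`. -/
def fight (B : ℕ) (j : Fin N) (t : ℕ) : Fin 3 ⊕ ι → ℕ :=
  Sum.elim ![B + D.reserve t, 0, D.lure j] (D.bid t)

/-- The weights on group `j` of its owner, who plays the even times `t` of the duel. At the end of
the duel, at time `2 * l`, the owner takes the key item, and the last agent loses the lure. -/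
def hold (j : Fin N) (t : ℕ) : Fin 3 ⊕ ι → ℕ :=
  Sum.elim ![0, D.reserve t + if t = 2 * l then 0 else D.lure j,
    if t = 2 * l then 2 * D.lure j else 0] (D.bid t)

/-- The weights that are `B` on the big item of a group and zero on all others. -/
def bigOnly (ι : Type) (B : ℕ) : Fin 3 ⊕ ι → ℕ := Sum.elim ![B, 0, 0] 0

/-- The weights that are one on the big item of every group and zero on all other items. They are
part of every clause of the last agent, who therefore always wins all big items. -/
def flat (N : ℕ) (ι : Type) (y : Fin N × (Fin 3 ⊕ ι)) : ℕ := bigOnly ι 1 y.2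

/-- The clauses of the last agent. -/
def topClause (B : ℕ) : Option (Fin N × Fin (l + 1)) → Fin N × (Fin 3 ⊕ ι) → ℕ
  | none => flat N ι
  | some (j, q) => flat N ι + onGroup j (D.fight B j (2 * q + 1))

/-- The clauses of the owner of group `j`. All agents share one type of clauses, so that the first
component of a clause is redundant here. The clause `none` only serves to make the optimum large. -/
def ownerClause (B : ℕ) (j : Fin N) : Option (Fin N × Fin (l + 1)) → Fin N × (Fin 3 ⊕ ι) → ℕ
  | none => onGroup j (bigOnly ι B)
  | some (_, q) => onGroup j (D.hold j (2 * q))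

/-- The clauses of all agents: agent `j.castSucc` is the owner of group `j`. -/
def clause (N B : ℕ) :
    Fin (N + 1) → Option (Fin N × Fin (l + 1)) → Fin N × (Fin 3 ⊕ ι) → ℕ :=
  Fin.snoc (D.ownerClause B) (D.topClause B)

@[simp]
theorem clause_last (B : ℕ) : D.clause N B (Fin.last N) = D.topClause B := Fin.snoc_last _ _

@[simp]
theorem clause_castSucc (B : ℕ) (j : Fin N) : D.clause N B j.castSucc = D.ownerClause B j :=
  Fin.snoc_castSucc _ _ _

/-- The bids if the owner of group `j` plays time `s j` of the duel and the last agent bids `x`. -/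
def profile (s : Fin N → ℕ) (x : Fin N × (Fin 3 ⊕ ι) → ℕ) :
    Fin (N + 1) → Fin N × (Fin 3 ⊕ ι) → ℕ :=
  Fin.snoc (fun j => onGroup j (D.hold j (s j))) x

variable {B : ℕ} {s : Fin N → ℕ} {x : Fin N × (Fin 3 ⊕ ι) → ℕ} {j : Fin N}

theorem natPrice_profile_last (y : Fin N × (Fin 3 ⊕ ι)) :
    natPrice (D.profile s x) (Fin.last N) y = D.hold y.1 (s y.1) y.2 :=
  natPrice_last (fun j => D.hold j (s j)) x y

theorem natPrice_profile_castSucc (z : Fin 3 ⊕ ι) :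
    natPrice (D.profile s x) j.castSucc (j, z) = x (j, z) :=
  natPrice_castSucc (fun j => D.hold j (s j)) x j z

section LastAgent

/-- What the last agent gains from fighting for group `j` with time `t` of the duel while its owner
plays time `s`, apart from the flat weights. -/
def fightGain (B : ℕ) (j : Fin N) (s t : ℕ) : ℕ :=
  B + (D.lure j - if s = 2 * l then 2 * D.lure j else 0) +
    (D.reserve t + ∑ e, (D.bid t e - D.bid s e))

theorem sum_flat : ∑ y, flat N ι y = N := by
  simp [flat, bigOnly, Fintype.sum_prod_type, Fin.sum_univ_three]

theorem sum_flat_add_sub (f : Fin N × (Fin 3 ⊕ ι) → ℕ) :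
    ∑ y, ((flat N ι + f) y - natPrice (D.profile s x) (Fin.last N) y) =
      N + ∑ y, (f y - natPrice (D.profile s x) (Fin.last N) y) := by
  refine Eq.trans ?_ (congrArg (· + _) (sum_flat (N := N) (ι := ι)))
  rw [← Finset.sum_add_distrib]
  refine Finset.sum_congr rfl fun y _ => ?_
  obtain ⟨j, c | e⟩ := y
  · rw [natPrice_profile_last, Pi.add_apply]
    fin_cases c <;> simp [flat, bigOnly, hold]
  · simp [flat, bigOnly]

theorem sum_topClause_none_sub :
    ∑ y, (D.topClause B none y - natPrice (D.profile s x) (Fin.last N) y) = N := by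
  simpa [topClause] using D.sum_flat_add_sub (s := s) (x := x) 0

theorem sum_topClause_some_sub (j : Fin N) (q : Fin (l + 1)) :
    ∑ y, (D.topClause B (some (j, q)) y - natPrice (D.profile s x) (Fin.last N) y) =
      N + D.fightGain B j (s j) (2 * q + 1) := by
  rw [topClause, sum_flat_add_sub, sum_onGroup_sub]
  simp only [natPrice_profile_last, Fintype.sum_sum_type, Fin.sum_univ_three, fightGain]
  simp [fight, hold]
  ring

theorem fightGain_lt {j' : Fin N} {t q : ℕ} (hq : q < l) (ht : t ≤ 2 * l + 1) (hodd : Odd t)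
    (hj : s j = 2 * q) (hbefore : ∀ j' < j, s j' = 2 * l) (hne : j' = j → t ≠ 2 * q + 1) :
    D.fightGain B j' (s j') t < D.fightGain B j (s j) (2 * q + 1) := by
  have hcore : D.reserve t + ∑ e, (D.bid t e - D.bid (s j') e) < D.gap :=
    (add_le_add_right (Finset.sum_le_sum fun e _ => Nat.sub_le _ _) _).trans_lt
      (D.reserve_add_sum_bid_lt_gap ht)
  have hlure := D.gap_le_lure j
  have hunfinished : s j ≠ 2 * l := by omega
  simp only [fightGain, if_neg hunfinished]
  rcases lt_trichotomy j' j with h | rfl | h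
  · rw [if_pos (hbefore j' h)]
    omega
  · have hbest := D.best (2 * q) t (by omega) ht ((even_two_mul q).add_odd hodd) (hne rfl)
    rw [hj, if_neg (hj ▸ hunfinished)]
    omega
  · have := D.lure_add_gap_le h
    omega

theorem fight_outbids_hold {q : ℕ} (hq : q < l) (z : Fin 3 ⊕ ι) :
    D.fight B j (2 * q + 1) z = 0 ∨ z = .inl 0 ∨
      D.hold j (2 * q) z < D.fight B j (2 * q + 1) z := by
  obtain c | e := z
  · have hlure : 0 < D.lure j := D.gap_pos.trans_le (D.gap_le_lure j)
    have hne : q ≠ l := hq.ne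
    fin_cases c <;> simp [fight, hold, hne, hlure]
  · simpa [fight, hold] using D.outbid (2 * q) e (by omega)

/-- The last agent fights for the first group whose owner is still in the duel. The condition on the
current bids `x` holds both when this fight begins and later in the duel. -/
theorem isNatDecisive_last {q : Fin (l + 1)} (hq : (q : ℕ) < l) (hj : s j = 2 * q)
    (hbefore : ∀ j' < j, s j' = 2 * l)
    (hx : ∀ e, (2 * (q : ℕ) ≠ 0 → D.bid (2 * q - 1) e = 0) → x (j, .inr e) = 0) :
    IsNatDecisive (D.clause N B) (D.profile s x) (Fin.last N) (some (j, q)) where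
  best c' := by
    rw [clause_last, sum_topClause_some_sub]
    match c' with
    | none =>
      right
      have hlure : 0 < D.lure j := D.gap_pos.trans_le (D.gap_le_lure j)
      have hne : s j ≠ 2 * l := by omega
      rw [sum_topClause_none_sub, fightGain, if_neg hne]
      omega
    | some (j', q') =>
      by_cases heq : j' = j ∧ q' = q
      · exact .inl (by rw [heq.1, heq.2])
      · right
        rw [sum_topClause_some_sub]
        refine Nat.add_lt_add_left (D.fightGain_lt hq (by omega) ⟨q', rfl⟩ hj hbefore ?_) N
        intro h1 h2
        exact heq ⟨h1, Fin.ext (by omega)⟩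
  outbid y := by
    rw [clause_last, natPrice_profile_last]
    obtain ⟨g, z⟩ := y
    by_cases hbig : z = .inl 0
    · right
      simp [hbig, topClause, flat, bigOnly, hold]
    have hflat : flat N ι (g, z) = 0 := by
      obtain c | e := z
      · fin_cases c <;> simp_all [flat, bigOnly]
      · simp [flat, bigOnly]
    by_cases hg : g = j
    · subst hg
      simpa [topClause, hflat, hj, hbig] using D.fight_outbids_hold (B := B) (j := g) hq z
    · left
      simp [topClause, hflat, onGroup_of_ne (y := (g, z)) hg]
  contested := by
    obtain ⟨e, hprev, hpos, hlt⟩ := D.progress (2 * q) (by omega)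
    refine ⟨(j, .inr e), ?_, ?_⟩
    · rw [natPrice_profile_last, profile, Fin.snoc_last, hx e hprev]
      simpa [hold, hj] using hpos
    · rw [natPrice_profile_last, clause_last]
      simpa [hold, hj, topClause, flat, bigOnly, fight] using hlt

end LastAgent

section Owner

theorem sum_onGroup_sub_natPrice_castSucc (f : Fin 3 ⊕ ι → ℕ) :
    ∑ y, (onGroup j f y - natPrice (D.profile s x) j.castSucc y) = ∑ z, (f z - x (j, z)) := by
  rw [sum_onGroup_sub]
  exact Finset.sum_congr rfl fun z _ => by rw [natPrice_profile_castSucc]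

theorem sum_bigOnly_sub_fight (q : ℕ) :
    ∑ z, (bigOnly ι B z - (flat N ι + onGroup j (D.fight B j (2 * q + 1))) (j, z)) = 0 := by
  rw [Fintype.sum_sum_type, Fin.sum_univ_three]
  simp [bigOnly, flat, fight]
  omega

theorem sum_hold_sub_fight (q q' : ℕ) :
    ∑ z, (D.hold j (2 * q') z - (flat N ι + onGroup j (D.fight B j (2 * q + 1))) (j, z)) =
      D.lure j + (D.reserve (2 * q') + ∑ e, (D.bid (2 * q') e - D.bid (2 * q + 1) e)) := by
  rw [Fintype.sum_sum_type, Fin.sum_univ_three]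
  by_cases h : q' = l <;> simp [hold, fight, flat, bigOnly, h] <;> omega

theorem hold_outbids_fight {q : ℕ} (hq : q < l) (z : Fin 3 ⊕ ι) :
    D.hold j (2 * (q + 1)) z = 0 ∨
      (flat N ι + onGroup j (D.fight B j (2 * q + 1))) (j, z) < D.hold j (2 * (q + 1)) z := by
  obtain c | e := z
  · have hlure : 0 < D.lure j := D.gap_pos.trans_le (D.gap_le_lure j)
    by_cases h : q + 1 = l <;> fin_cases c <;> simp [fight, hold, flat, bigOnly, h] <;> omega
  · rw [Nat.mul_succ]
    simpa [fight, hold, flat, bigOnly] using D.outbid (2 * q + 1) e (by omega)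

theorem isNatDecisive_castSucc {q : ℕ} {q' : Fin (l + 1)} (hq' : (q' : ℕ) = q + 1)
    (hj : s j = 2 * q) :
    IsNatDecisive (D.clause N B)
      (D.profile s (flat N ι + onGroup j (D.fight B j (2 * q + 1)))) j.castSucc (some (j, q')) where
  best c' := by
    have hlure : 0 < D.lure j := D.gap_pos.trans_le (D.gap_le_lure j)
    rw [clause_castSucc, ownerClause, sum_onGroup_sub_natPrice_castSucc, sum_hold_sub_fight, hq']
    match c' with
    | none =>
      right
      rw [ownerClause, sum_onGroup_sub_natPrice_castSucc, sum_bigOnly_sub_fight]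
      omega
    | some (_, r) =>
      rw [ownerClause, sum_onGroup_sub_natPrice_castSucc, sum_hold_sub_fight]
      by_cases hr : (r : ℕ) = q + 1
      · exact .inl (by rw [hr])
      · exact .inr (Nat.add_lt_add_left (D.best (2 * q + 1) (2 * r) (by omega) (by omega)
          (by simp [Nat.odd_add]) (by omega)) _)
  outbid y := by
    obtain ⟨g, z⟩ := y
    rw [clause_castSucc, ownerClause, hq']
    by_cases hg : g = j
    · subst hg
      rw [natPrice_profile_castSucc, onGroup_self]
      exact D.hold_outbids_fight (by omega) z
    · exact .inl (onGroup_of_ne hg _)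
  contested := by
    obtain ⟨e, hprev, hpos, hlt⟩ := D.progress (2 * q + 1) (by omega)
    have hzero : D.bid (2 * q) e = 0 := hprev (Nat.succ_ne_zero _)
    refine ⟨(j, .inr e), ?_, ?_⟩ <;> rw [natPrice_profile_castSucc]
    · simpa [profile, hold, hj, hzero, flat, bigOnly, fight] using hpos
    · rw [clause_castSucc, ownerClause, hq', Nat.mul_succ]
      simpa [hold, flat, bigOnly, fight] using hlt

end Owner

end Duel

section Schedule

/-- The number of rounds that the duel for group `j` has advanced after `ρ` rounds in total, if the
groups are fought for one after the other, with `l` rounds each. -/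
def front (l ρ j : ℕ) : ℕ := min (ρ - j * l) l

theorem front_mul_add {l g q : ℕ} (hq : q ≤ l) (j : ℕ) :
    front l (g * l + q) j = if j < g then l else if j = g then q else 0 := by
  unfold front
  split_ifs with hlt heq
  · have := Nat.mul_le_mul_right l (Nat.succ_le_of_lt hlt)
    rw [Nat.succ_mul] at this
    omega
  · rw [heq]
    omega
  · have := Nat.mul_le_mul_right l (Nat.succ_le_of_lt (show g < j by omega))
    rw [Nat.succ_mul] at this
    omega

variable {N l : ℕ}

theorem exists_eq_mul_add {ρ : ℕ} (hρ : ρ < N * l) :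
    ∃ (j : Fin N) (q : ℕ), q < l ∧ ρ = j * l + q := by
  have hl : 0 < l := Nat.pos_of_mul_pos_left (Nat.zero_lt_of_lt hρ)
  exact ⟨⟨ρ / l, Nat.div_lt_of_lt_mul (by rwa [mul_comm] at hρ)⟩, ρ % l, Nat.mod_lt _ hl,
    (Nat.div_add_mod' ρ l).symm⟩

variable [NeZero N]

/-- The group that is fought for in round `ρ`, for `ρ < N * l`. -/
def groupAt (N : ℕ) [NeZero N] (l ρ : ℕ) : Fin N := Fin.ofNat N (ρ / l)

theorem groupAt_mul_add (j : Fin N) {q : ℕ} (hq : q < l) : groupAt N l (j * l + q) = j := by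
  ext
  rw [groupAt, Fin.val_ofNat, add_comm, Nat.add_mul_div_right _ _ (Nat.zero_lt_of_lt hq),
    Nat.div_eq_of_lt hq, zero_add, Nat.mod_eq_of_lt j.isLt]

/-- In each round the last agent moves first, and then the owner of the current group. -/
def schedule (N : ℕ) [NeZero N] (l t : ℕ) : Fin (N + 1) :=
  if Even t then Fin.last N else (groupAt N l (t / 2)).castSucc

theorem schedule_two_mul (ρ : ℕ) : schedule N l (2 * ρ) = Fin.last N := if_pos (even_two_mul ρ)

theorem schedule_two_mul_add_one (j : Fin N) {q : ℕ} (hq : q < l) :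
    schedule N l (2 * (j * l + q) + 1) = j.castSucc := by
  rw [schedule, if_neg (Nat.not_even_two_mul_add_one _),
    show (2 * (j * l + q) + 1) / 2 = j * l + q by omega, groupAt_mul_add j hq]

theorem le_activations {n r T : ℕ} {act : ℕ → Fin n} {i : Fin n} {g : ℕ → ℕ}
    (hg : Function.Injective g) (h : ∀ q < r, g q < T ∧ act (g q) = i) :
    r ≤ activations act T i := by
  rw [← Finset.card_range r, activations]
  refine Finset.card_le_card_of_injOn g (fun q hq => ?_) hg.injOn
  simpa using h q (Finset.mem_range.1 hq)

theorem le_activations_schedule (i : Fin (N + 1)) :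
    l ≤ activations (schedule N l) (2 * (N * l)) i := by
  cases i using Fin.lastCases with
  | last =>
    refine le_activations (mul_right_injective₀ two_ne_zero) fun q hq => ⟨?_, schedule_two_mul q⟩
    have := Nat.le_mul_of_pos_left l (NeZero.pos N)
    omega
  | cast j =>
    refine le_activations (g := fun q => 2 * (j * l + q) + 1) (fun q q' h => by simpa using h)
      fun q hq => ⟨?_, schedule_two_mul_add_one j hq⟩
    have := Nat.mul_le_mul_right l (Nat.succ_le_of_lt j.isLt)
    rw [Nat.succ_mul] at this
    omega

end Schedule

namespace Duel

variable {ι : Type} [Fintype ι] {l : ℕ} (D : Duel ι l) {N : ℕ} {B : ℕ}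

theorem profile_eq_update_last (s : Fin N → ℕ) (x x' : Fin N × (Fin 3 ⊕ ι) → ℕ) :
    D.profile s x' = Function.update (D.profile s x) (Fin.last N) x' :=
  (Fin.update_snoc_last _ _ _).symm

theorem profile_update (s : Fin N → ℕ) (x : Fin N × (Fin 3 ⊕ ι) → ℕ) (j : Fin N) (t : ℕ) :
    D.profile (Function.update s j t) x =
      Function.update (D.profile s x) j.castSucc (onGroup j (D.hold j t)) := by
  rw [profile, profile, ← Fin.snoc_update]
  congr 1
  funext j'
  exact Function.apply_update (fun g t => onGroup g (D.hold g t)) s j t j'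

variable [NeZero N]

/-- The bids of the last agent after `ρ` of its moves. -/
def topBids (B : ℕ) : ℕ → Fin N × (Fin 3 ⊕ ι) → ℕ
  | 0 => flat N ι
  | ρ + 1 => flat N ι + onGroup (groupAt N l ρ) (D.fight B (groupAt N l ρ) (2 * (ρ % l) + 1))

theorem topBids_succ (j : Fin N) {q : ℕ} (hq : q < l) :
    D.topBids B (j * l + q + 1) = flat N ι + onGroup j (D.fight B j (2 * q + 1)) := by
  rw [topBids, groupAt_mul_add j hq, Nat.mul_add_mod_self_right, Nat.mod_eq_of_lt hq]

theorem topBids_inr_eq_zero (j : Fin N) {q : ℕ} (hq : q < l) {e : ι}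
    (h : 2 * q ≠ 0 → D.bid (2 * q - 1) e = 0) : D.topBids B (j * l + q) (j, .inr e) = 0 := by
  obtain _ | q := q
  · obtain ⟨_ | g, hj⟩ := j
    · simp [topBids, flat, bigOnly]
    · have hg : g < N := Nat.lt_of_succ_lt hj
      have heq : (g + 1) * l + 0 = (⟨g, hg⟩ : Fin N) * l + (l - 1) + 1 := by
        rw [Nat.succ_mul]
        dsimp only
        omega
      rw [heq, D.topBids_succ ⟨g, hg⟩ (by omega)]
      simp [flat, bigOnly, onGroup]
  · rw [← add_assoc, D.topBids_succ j (by omega)]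
    simpa [flat, bigOnly, fight, Nat.mul_succ] using h

/-- The bids after `t` steps. -/
def state (N : ℕ) [NeZero N] (B t : ℕ) : Fin (N + 1) → Fin N × (Fin 3 ⊕ ι) → ℕ :=
  D.profile (fun j => 2 * front l (t / 2) j) (D.topBids B ((t + 1) / 2))

theorem state_two_mul (ρ : ℕ) :
    D.state N B (2 * ρ) = D.profile (fun j => 2 * front l ρ j) (D.topBids B ρ) := by
  rw [state, Nat.mul_div_cancel_left ρ two_pos, show (2 * ρ + 1) / 2 = ρ by omega]

theorem state_two_mul_add_one (ρ : ℕ) :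
    D.state N B (2 * ρ + 1) = D.profile (fun j => 2 * front l ρ j) (D.topBids B (ρ + 1)) := by
  rw [state, show (2 * ρ + 1) / 2 = ρ by omega, show (2 * ρ + 1 + 1) / 2 = ρ + 1 by omega]

theorem exists_isNatDecisive_state_two_mul (j : Fin N) {q : ℕ} (hq : q < l) :
    ∃ c, IsNatDecisive (D.clause N B) (D.state N B (2 * (j * l + q))) (Fin.last N) c ∧
      D.state N B (2 * (j * l + q) + 1) = Function.update (D.state N B (2 * (j * l + q)))
        (Fin.last N) (D.clause N B (Fin.last N) c) := by
  refine ⟨some (j, ⟨q, by omega⟩), ?_, ?_⟩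
  · rw [state_two_mul]
    refine D.isNatDecisive_last hq ?_ (fun j' hj' => ?_) fun e he => D.topBids_inr_eq_zero j hq he
    · simp [front_mul_add hq.le]
    · simp [front_mul_add hq.le, hj']
  · rw [state_two_mul, state_two_mul_add_one, D.topBids_succ j hq, clause_last, topClause,
      ← profile_eq_update_last]

theorem exists_isNatDecisive_state_two_mul_add_one (j : Fin N) {q : ℕ} (hq : q < l) :
    ∃ c, IsNatDecisive (D.clause N B) (D.state N B (2 * (j * l + q) + 1)) j.castSucc c ∧
      D.state N B (2 * (j * l + q) + 2) = Function.update (D.state N B (2 * (j * l + q) + 1))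
        j.castSucc (D.clause N B j.castSucc c) := by
  refine ⟨some (j, ⟨q + 1, by omega⟩), ?_, ?_⟩
  · rw [state_two_mul_add_one, D.topBids_succ j hq]
    exact D.isNatDecisive_castSucc rfl (by simp [front_mul_add hq.le])
  · rw [← Nat.mul_succ, state_two_mul, state_two_mul_add_one, clause_castSucc, ownerClause,
      ← profile_update]
    congr 1
    funext j'
    rw [Nat.succ_eq_add_one, add_assoc, front_mul_add hq, Function.update_apply,
      front_mul_add hq.le]
    simp only [Fin.ext_iff]
    split_ifs <;> first | rfl | omega

theorem exists_isNatDecisive_state {t : ℕ} (ht : t < 2 * (N * l)) :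
    ∃ c, IsNatDecisive (D.clause N B) (D.state N B t) (schedule N l t) c ∧
      D.state N B (t + 1) = Function.update (D.state N B t) (schedule N l t)
        (D.clause N B (schedule N l t) c) := by
  obtain ⟨ρ, rfl | rfl⟩ := Nat.even_or_odd' t
  all_goals obtain ⟨j, q, hq, rfl⟩ := exists_eq_mul_add (show ρ < N * l by omega)
  · rw [schedule_two_mul]
    exact D.exists_isNatDecisive_state_two_mul j hq
  · rw [schedule_two_mul_add_one j hq]
    exact D.exists_isNatDecisive_state_two_mul_add_one j hq

end Duel

section Welfare

theorem sum_comp_le_sum {α β : Type*} [Fintype β] (σ : α ≃ β) (S : Finset α) (f : β → ℕ) :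
    ∑ x ∈ S, f (σ x) ≤ ∑ y, f y :=
  (Finset.sum_map S σ.toEmbedding f).ge.trans
    (Finset.sum_le_sum_of_subset (Finset.subset_univ _))

namespace Duel

variable {ι : Type} [Fintype ι] {l : ℕ} (D : Duel ι l) {N B : ℕ}

theorem sum_fight_le (j : Fin N) {t : ℕ} (ht : t ≤ 2 * l + 1) :
    ∑ z, D.fight B j t z ≤ B + (N + 1) * D.gap := by
  have hlure := D.lure_le j
  have hgap := D.reserve_add_sum_bid_lt_gap ht
  simp only [Fintype.sum_sum_type, Fin.sum_univ_three, fight, Sum.elim_inl, Sum.elim_inr]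
  simp only [Matrix.cons_val]
  rw [Nat.succ_mul]
  omega

theorem sum_hold_le (j : Fin N) {t : ℕ} (ht : t ≤ 2 * l + 1) :
    ∑ z, D.hold j t z ≤ (2 * N + 1) * D.gap := by
  have hlure := D.lure_le j
  have hgap := D.reserve_add_sum_bid_lt_gap ht
  simp only [Fintype.sum_sum_type, Fin.sum_univ_three, hold, Sum.elim_inl, Sum.elim_inr]
  simp only [Matrix.cons_val]
  rw [Nat.succ_mul (2 * N), mul_assoc]
  split_ifs <;> omega

variable {m : ℕ} (σ : Fin m ≃ Fin N × (Fin 3 ⊕ ι)) {S : Finset (Fin m)}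

/-- The instance of the duel for the items numbered by `σ`. -/
noncomputable def auction (B : ℕ) : XOSInstance (N + 1) m := natInstance σ (D.clause N B)

theorem value_last_le (S : Finset (Fin m)) :
    (D.auction σ B).value (Fin.last N) S ≤ (B + (N + (N + 1) * D.gap) : ℕ) := by
  refine natInstance_value_le fun c => (sum_comp_le_sum σ S _).trans ?_
  rw [clause_last]
  match c with
  | none =>
    rw [topClause, sum_flat]
    omega
  | some (j, q) =>
    have := D.sum_fight_le (B := B) j (t := 2 * q + 1) (by omega)
    simp only [topClause, Pi.add_apply, Finset.sum_add_distrib, sum_flat, sum_onGroup]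
    omega

theorem value_castSucc_le (j : Fin N) (hS : σ.symm (j, .inl 0) ∉ S) :
    (D.auction σ B).value j.castSucc S ≤ ((2 * N + 1) * D.gap : ℕ) := by
  refine natInstance_value_le fun c => ?_
  rw [clause_castSucc]
  match c with
  | none =>
    refine (Finset.sum_eq_zero fun x hx => ?_).trans_le (Nat.zero_le _)
    obtain ⟨⟨g, z⟩, rfl⟩ := σ.symm.surjective x
    rw [ownerClause, Equiv.apply_symm_apply]
    unfold onGroup
    split_ifs with hg
    · obtain c | e := z
      · fin_cases c
        · exact absurd (hg ▸ hx) hS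
        · rfl
        · rfl
      · rfl
    · rfl
  | some (_, q) =>
    rw [ownerClause]
    exact (sum_comp_le_sum σ S _).trans
      ((sum_onGroup j _).trans_le (D.sum_hold_le j (by omega)))

theorem mul_le_opt : (N * B : ℕ) ≤ (D.auction σ B).opt := by
  have hvalue (j : Fin N) : (B : ℝ≥0) ≤ (D.auction σ B).value j.castSucc
      (Finset.univ.filter fun x => (σ x).1.castSucc = j.castSucc) := by
    refine le_trans ?_ (sum_le_natInstance_value none _)
    have hmem : σ.symm (j, .inl 0) ∈
        Finset.univ.filter fun x => (σ x).1.castSucc = j.castSucc := by simp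
    refine Nat.cast_le.2 (le_trans ?_ (Finset.single_le_sum (fun _ _ => Nat.zero_le _) hmem))
    simp [ownerClause, bigOnly]
  calc ((N * B : ℕ) : ℝ≥0) = ∑ _j : Fin N, (B : ℝ≥0) := by simp
    _ ≤ ∑ i, (D.auction σ B).value i (Finset.univ.filter fun x => (σ x).1.castSucc = i) := by
      rw [Fin.sum_univ_castSucc]
      exact le_add_of_le_of_nonneg (Finset.sum_le_sum fun j _ => hvalue j) zero_le
    _ ≤ (D.auction σ B).opt := Finset.le_sup
      (f := fun o : Fin m → Fin (N + 1) =>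
        ∑ i, (D.auction σ B).value i (Finset.univ.filter fun x => o x = i))
      (Finset.mem_univ fun x => (σ x).1.castSucc)

/-- A bound on the total value of all items other than one big item. -/
def excess (N : ℕ) : ℕ := N + (N + 1) * D.gap + N * ((2 * N + 1) * D.gap)

variable [NeZero N]

theorem flat_le_topBids (ρ : ℕ) : flat N ι ≤ D.topBids B ρ := by
  cases ρ
  exacts [le_rfl, fun y => Nat.le_add_right _ _]

theorem big_notMem_won_state (R : AllocationRule (N + 1) m) (t : ℕ) (j j' : Fin N) :
    σ.symm (j', .inl 0) ∉ R.won (castBids σ (D.state N B t)) j.castSucc := by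
  intro hwon
  have hle := R.le_of_mem_won hwon (Fin.last N)
  have hflat : 1 ≤ D.topBids B ((t + 1) / 2) (j', .inl 0) := D.flat_le_topBids _ (j', .inl 0)
  rw [castBids, castBids, Equiv.apply_symm_apply, Nat.cast_le, state, profile, Fin.snoc_last,
    Fin.snoc_castSucc] at hle
  have hzero : onGroup j (D.hold j (2 * front l (t / 2) j)) (j', .inl 0) = 0 := by
    simp [onGroup, hold]
  omega

theorem socialWelfare_state_le (R : AllocationRule (N + 1) m) (t : ℕ) :
    socialWelfare R (D.auction σ B) (castBids σ (D.state N B t)) ≤ (B + D.excess N : ℕ) := by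
  have howners := Finset.sum_le_sum fun j (_ : j ∈ Finset.univ) =>
    D.value_castSucc_le (B := B) σ j (D.big_notMem_won_state (B := B) σ R t j j)
  rw [Finset.sum_const, Finset.card_univ, Fintype.card_fin, nsmul_eq_mul] at howners
  rw [socialWelfare, Fin.sum_univ_castSucc]
  refine (add_le_add howners (D.value_last_le σ _)).trans_eq ?_
  push_cast [excess]
  ring

theorem strongNoOverbidding_state_zero :
    StrongNoOverbidding (D.auction σ B) (castBids σ (D.state N B 0)) := by
  intro i S
  obtain ⟨c, hc⟩ : ∃ c, D.state N B 0 i = D.clause N B i c := by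
    cases i using Fin.lastCases with
    | last => exact ⟨none, by rw [clause_last, state, profile, Fin.snoc_last]; rfl⟩
    | cast j =>
      refine ⟨some (j, 0), ?_⟩
      rw [clause_castSucc, state, profile, Fin.snoc_castSucc]
      simp [ownerClause, front]
  have hclause := sum_le_natInstance_value (σ := σ) (w := D.clause N B) (i := i) c S
  rw [← hc, Nat.cast_sum] at hclause
  exact hclause

theorem eq_castBids_state {R : AllocationRule (N + 1) m} {b : ℕ → Bids (N + 1) m}
    (hb : IsPotentialRun R (D.auction σ B) (castBids σ (D.state N B 0)) (schedule N l) b) :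
    ∀ t ≤ 2 * (N * l), b t = castBids σ (D.state N B t) :=
  hb.eq_of_isDecisive rfl fun t ht => by
    obtain ⟨c, hdec, hnext⟩ := D.exists_isNatDecisive_state ht
    rw [hnext]
    exact hdec.exists_isDecisive σ

theorem not_isBestResponse_state (R : AllocationRule (N + 1) m) {t : ℕ} (ht : t < 2 * (N * l)) :
    ¬ IsBestResponse R (D.auction σ B) (castBids σ (D.state N B t)) (schedule N l t) := by
  obtain ⟨c, hdec, -⟩ := D.exists_isNatDecisive_state (B := B) ht
  obtain ⟨ℓ, hℓ, -⟩ := hdec.exists_isDecisive σ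
  exact hℓ.not_isBestResponse

end Duel

end Welfare

section SlowStart

variable {n m : ℕ}

/-- For some instance and initial bids with strong no-overbidding, a sequence of activations forces
the Potential Procedure to keep improving for `r` activations of each agent, while the social
welfare stays below `(1 + ε) / (n - 1)` times the optimum. -/
def HasSlowStart (R : AllocationRule n m) (ε : ℝ) (r : ℕ) : Prop :=
  ∃ (I : XOSInstance n m) (b₀ : Bids n m) (act : ℕ → Fin n) (T : ℕ),
    StrongNoOverbidding I b₀ ∧
    (∀ i : Fin n, r ≤ activations act T i) ∧
    ∀ b : ℕ → Bids n m, IsPotentialRun R I b₀ act b →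
      (∀ t < T, ¬ IsBestResponse R I (b t) (act t)) ∧
      (∀ t ≤ T, (socialWelfare R I (b t) : ℝ) ≤ (1 + ε) / ((n : ℝ) - 1) * (I.opt : ℝ))

theorem hasSlowStart_zero [NeZero n] (R : AllocationRule n m) (ε : ℝ) : HasSlowStart R ε 0 := by
  refine ⟨⟨0, 0⟩, 0, 0, 0, fun i S => ?_, fun i => Nat.zero_le _, fun b _ => ⟨?_, fun t _ => ?_⟩⟩
  · simp
  · simp
  · simp [socialWelfare, XOSInstance.opt, XOSInstance.value, Finset.sup_const Finset.univ_nonempty]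

theorem Duel.hasSlowStart {ι : Type} [Fintype ι] {l N : ℕ} [NeZero N] (D : Duel ι l)
    (σ : Fin m ≃ Fin N × (Fin 3 ⊕ ι)) (R : AllocationRule (N + 1) m) {ε : ℝ} (hε : 0 < ε) :
    HasSlowStart R ε l := by
  obtain ⟨B, hB⟩ := exists_nat_ge ((D.excess N : ℝ) / ε)
  refine ⟨D.auction σ B, castBids σ (D.state N B 0), schedule N l, 2 * (N * l),
    D.strongNoOverbidding_state_zero σ, le_activations_schedule,
    fun b hb => ⟨fun t ht => ?_, fun t ht => ?_⟩⟩ <;> rw [D.eq_castBids_state σ hb t (by omega)]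
  · exact D.not_isBestResponse_state σ R ht
  have hN : (0 : ℝ) < N := Nat.cast_pos.2 (NeZero.pos N)
  have hexcess : (D.excess N : ℝ) ≤ B * ε := (div_le_iff₀ hε).1 hB
  calc (socialWelfare R (D.auction σ B) (castBids σ (D.state N B t)) : ℝ)
      ≤ B + D.excess N := by exact_mod_cast D.socialWelfare_state_le σ R t
    _ ≤ (1 + ε) * B := by linarith
    _ = (1 + ε) / ((N + 1 : ℕ) - 1) * (N * B : ℕ) := by
      rw [Nat.cast_succ, add_sub_cancel_right, Nat.cast_mul]
      field_simp
    _ ≤ (1 + ε) / ((N + 1 : ℕ) - 1) * (D.auction σ B).opt := by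
      have hfactor : 0 ≤ (1 + ε) / (((N + 1 : ℕ) : ℝ) - 1) := by
        rw [Nat.cast_succ, add_sub_cancel_right]
        positivity
      exact mul_le_mul_of_nonneg_left (by exact_mod_cast D.mul_le_opt σ) hfactor

theorem hasSlowStart_two_pow {ε : ℝ} (hε : 0 < ε) (hn : 2 ≤ n) (k : ℕ)
    (R : AllocationRule n ((n - 1) * (k + 1))) : HasSlowStart R ε (2 ^ (k - 6) - 1) := by
  obtain ⟨N, rfl⟩ := Nat.exists_eq_add_of_le' (Nat.one_le_of_lt hn)
  have : NeZero N := ⟨by omega⟩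
  rcases Nat.lt_or_ge k 7 with hk | hk
  · rw [Nat.sub_eq_zero_of_le (Nat.le_of_lt_succ hk)]
    exact hasSlowStart_zero R ε
  obtain ⟨κ, rfl⟩ := Nat.exists_eq_add_of_le' hk
  obtain ⟨ι, _, hcard, ⟨D⟩⟩ := exists_duel κ
  have hitems : Fintype.card (Fin N × (Fin 3 ⊕ ι)) = (N + 1 - 1) * (κ + 7 + 1) := by
    simp only [Fintype.card_prod, Fintype.card_sum, Fintype.card_fin, hcard, Nat.add_sub_cancel]
    ring
  exact D.hasSlowStart (Fintype.equivFinOfCardEq hitems).symm R hε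

theorem isBigO_two_pow_sub :
    Asymptotics.IsBigO Filter.atTop (fun k : ℕ => (2 : ℝ) ^ k)
      (fun k : ℕ => ((2 ^ (k - 6) - 1 : ℕ) : ℝ)) := by
  refine Asymptotics.IsBigO.of_bound 128 (Filter.eventually_atTop.2 ⟨7, fun k hk => ?_⟩)
  obtain ⟨κ, rfl⟩ := Nat.exists_eq_add_of_le' hk
  have hpow : (1 : ℝ) ≤ 2 ^ κ := one_le_pow₀ one_le_two
  have hcast : ((2 ^ (κ + 7 - 6) - 1 : ℕ) : ℝ) = 2 * 2 ^ κ - 1 := by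
    rw [show κ + 7 - 6 = κ + 1 by omega, Nat.cast_sub Nat.one_le_two_pow]
    push_cast
    ring
  rw [hcast, Real.norm_of_nonneg (by positivity), Real.norm_of_nonneg (by linarith), pow_add]
  linarith

end SlowStart

theorem theorem5p3 :
    ∃ f : ℕ → ℕ,
      Asymptotics.IsBigO Filter.atTop (fun k : ℕ => (2 : ℝ) ^ k) (fun k : ℕ => (f k : ℝ)) ∧
      ∀ (ε : ℝ), 0 < ε → ∀ (n : ℕ), 2 ≤ n → ∀ (k : ℕ)
        (R : AllocationRule n ((n - 1) * (k + 1))),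
        ∃ (I : XOSInstance n ((n - 1) * (k + 1))) (b₀ : Bids n ((n - 1) * (k + 1)))
          (act : ℕ → Fin n) (T : ℕ),
          StrongNoOverbidding I b₀ ∧
          (∀ i : Fin n, f k ≤ activations act T i) ∧
          ∀ b : ℕ → Bids n ((n - 1) * (k + 1)), IsPotentialRun R I b₀ act b →
            (∀ t < T, ¬ IsBestResponse R I (b t) (act t)) ∧
            (∀ t ≤ T, (socialWelfare R I (b t) : ℝ) ≤ (1 + ε) / ((n : ℝ) - 1) * (I.opt : ℝ)) :=
  ⟨fun k => 2 ^ (k - 6) - 1, isBigO_two_pow_sub,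
    fun _ hε _ hn k R => hasSlowStart_two_pow hε hn k R⟩
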